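/- **Weak splitting.** In the deterministic LOCAL model, a network of $n$ nodes is a finite simple graph whose nodes have pairwise distinct identifiers and communicate in synchronous rounds; in each round every node may perform arbitrary local computation and send one message of arbitrary size to each of its neighbors. In the weak splitting problem the network is a bipartite graph in which every node knows whether it is on the left or on the right side, and the task is to color the right nodes with two colors such that every left node has at least one neighbor of each color. There are a deterministic LOCAL algorithm and an absolute constant $C>0$ such that the following holds for all integers $n\ge 1$, $r\ge 1$ and $\delta\ge 2(r+1)$. On every $n$-node bipartite graph whose left nodes all have degree at least $\delta$ and whose right nodes all have degree at most $r$ (where $n$, $\delta$ and $r$ are known to all nodes), for every assignment of distinct identifiers, the algorithm solves the weak splitting problem within at most $C\cdot\log_{\delta/r} n$ rounds, the number of rounds being a function of $n$, $\delta$ and $r$ only. -/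

import Mathlib

/-- The two sides of a bipartite graph. Every node knows its own side. -/
inductive Side where
  | left
  | right
  deriving DecidableEq

/-- The two colors of a weak splitting. -/
inductive Color where
  | red
  | blue
  deriving DecidableEq

/-- A communication network of the LOCAL model on the node set `V`: a simple graph, pairwise
distinct identifiers, a local input at each node, and an arbitrary numbering of the incident edges
of every node by ports `0, …, degree - 1`. -/
structure Network (V : Type) (Input : Type) where
  graph : SimpleGraph V
  [locallyFinite : graph.LocallyFinite]
  id : V → ℕ
  id_injective : Function.Injective id
  input : V → Input
  /-- `port v i` is the neighbor that `v` reaches through its port `i`. -/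
  port : ∀ v : V, Fin (graph.degree v) ≃ graph.neighborSet v

attribute [instance] Network.locallyFinite

/-- A deterministic algorithm in the LOCAL model. All nodes execute the same code. Local computation
and message size are unrestricted. The type `Param` holds the global parameters known to all nodes,
and the number of communication rounds is a function of these parameters only. -/
structure LocalAlgorithm (Param Input Output : Type) where
  /-- local states of a node -/
  State : Type
  /-- messages -/
  Msg : Type
  /-- number of communication rounds after which every node outputs -/
  rounds : Param → ℕ
  /-- Initial state: a node knows the global parameters, its identifier, its degree, its input. -/
  init : Param → (id : ℕ) → (degree : ℕ) → Input → State
  /-- The message that a node of degree `d` sends through each of its `d` ports. -/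
  send : (d : ℕ) → State → Fin d → Msg
  /-- New state of a node of degree `d`, from its old state and the messages received at each of its
  `d` ports. -/
  receive : (d : ℕ) → State → (Fin d → Msg) → State
  /-- Output of a node, computed from its final state. -/
  output : State → Output

namespace LocalAlgorithm

variable {Param Input Output V : Type}

/-- The state of every node after `t` synchronous rounds. In a round, the message arriving at port
`i` of `v` is the one that the neighbor `u` behind this port sends through its own port to `v`. -/
def stateAfter (A : LocalAlgorithm Param Input Output) (p : Param) (N : Network V Input) :
    ℕ → V → A.State
  | 0 => fun v => A.init p (N.id v) (N.graph.degree v) (N.input v)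
  | t + 1 => fun v =>
      A.receive (N.graph.degree v) (stateAfter A p N t v) fun i =>
        let u := N.port v i
        A.send (N.graph.degree u.1) (stateAfter A p N t u.1)
          ((N.port u.1).symm ⟨v, SimpleGraph.Adj.symm u.2⟩)

/-- The outputs of all nodes after the last round. -/
def run (A : LocalAlgorithm Param Input Output) (p : Param) (N : Network V Input) (v : V) :
    Output :=
  A.output (stateAfter A p N (A.rounds p) v)

end LocalAlgorithm

/-- `side` is a bipartition of `G`: every edge joins a left node and a right node. -/
def IsBipartition {V : Type} (G : SimpleGraph V) (side : V → Side) : Prop :=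
  ∀ u v, G.Adj u v → side u ≠ side v

/-- `c` solves weak splitting: every left node has a neighbor of each color. As all neighbors of left
nodes are right nodes, only the colors of the right nodes matter. -/
def IsWeakSplitting {V : Type} (G : SimpleGraph V) (side : V → Side) (c : V → Color) : Prop :=
  ∀ v, side v = Side.left → ∀ k : Color, ∃ u, G.Adj v u ∧ side u = Side.right ∧ c u = k

/-- Global parameters of a weak splitting instance: the number `n` of nodes, a lower bound `δ` on the
left degrees and an upper bound `r` on the right degrees. -/
structure SplittingParams where
  n : ℕ
  δ : ℕ
  r : ℕ

/-! The heart is linear algebra. If a set `T` of nodes outnumbers the nodes `M` constraining it,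
some nonzero real weighting of `T` sums to zero around each node of `M`; its positive and negative
parts split `T` so that a node of `M` seeing a nonzero weight sees both signs. Hence a maximal split
pair cannot be extended: any further `T` has at least `T.card` neighbors that miss the pair
(`SplitPair.card_le_of_maximal`).

If a left node `v` misses a maximal pair inside its ball of radius `2 * K + 1`, the left nodes
missing the pair grow by a factor `δ / r` every two steps, and `K ≥ log_{δ/r} n` exhausts the graph,
which is absurd (`exists_splitPair`).

Locally found pairs may overlap, so each node obeys the first pair containing it. For a left node,
the first of all pairs touching its neighborhood is then obeyed by every neighbor it contains, and
it supplies both colors (`Network.isWeakSplitting_chosenColor`). -/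

/-- A pair of disjoint sets of nodes such that every neighbor of one of them has neighbors in both. -/
structure SplitPair {V : Type} (G : SimpleGraph V) (A B : Finset V) : Prop where
  disjoint : Disjoint A B
  left : ∀ u, u ∈ A ∨ u ∈ B → ∀ v, G.Adj v u → ∃ a ∈ A, G.Adj v a
  right : ∀ u, u ∈ A ∨ u ∈ B → ∀ v, G.Adj v u → ∃ b ∈ B, G.Adj v b

/-! ### Balls in a graph -/

/-- `u` is at distance at most `t` from `v`. -/
def Within {V : Type} (G : SimpleGraph V) (t : ℕ) (v u : V) : Prop :=
  ∃ p : G.Walk v u, p.length ≤ t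

namespace Within

variable {V : Type} {G : SimpleGraph V} {s t : ℕ} {u v w : V}

theorem refl (v : V) : Within G t v v := ⟨.nil, by simp⟩

theorem symm (h : Within G t v u) : Within G t u v := by
  obtain ⟨p, hp⟩ := h
  exact ⟨p.reverse, by simpa using hp⟩

theorem mono (hst : s ≤ t) (h : Within G s v u) : Within G t v u := by
  obtain ⟨p, hp⟩ := h
  exact ⟨p, hp.trans hst⟩

theorem cons (h : G.Adj v w) (h' : Within G t w u) : Within G (t + 1) v u := by
  obtain ⟨p, hp⟩ := h'
  exact ⟨.cons h p, by simpa using hp⟩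

theorem concat (h : Within G t v w) (h' : G.Adj w u) : Within G (t + 1) v u :=
  (h.symm.cons h'.symm).symm

theorem zero_iff : Within G 0 v u ↔ u = v := by
  constructor
  · rintro ⟨p, hp⟩
    exact (SimpleGraph.Walk.eq_of_length_eq_zero (Nat.le_zero.mp hp)).symm
  · rintro rfl
    exact refl _

theorem succ_iff : Within G (t + 1) v u ↔ Within G t v u ∨ ∃ w, G.Adj v w ∧ Within G t w u := by
  constructor
  · rintro ⟨p, hp⟩
    cases p with
    | nil => exact .inl (refl _)
    | cons h p => exact .inr ⟨_, h, p, by simpa using hp⟩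
  · rintro (h | ⟨w, h, h'⟩)
    · exact h.mono (Nat.le_succ t)
    · exact h'.cons h

end Within

/-! ### Existence of split pairs of small radius -/

section Existence

variable {V : Type} {G : SimpleGraph V}

/-- A homogeneous linear system with more unknowns (`T`) than equations (`M`) has a nontrivial
kernel. -/
theorem exists_ne_zero_sum_eq_zero {α β : Type} (E : β → α → Prop)
    [∀ b, DecidablePred (E b)] (T : Finset α) (M : Finset β) (h : M.card < T.card) :
    ∃ x : α → ℝ, (∃ u ∈ T, x u ≠ 0) ∧ ∀ w ∈ M, ∑ u ∈ T with E w u, x u = 0 := by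
  classical
  let f : (T → ℝ) →ₗ[ℝ] (M → ℝ) := (Matrix.of fun (w : M) (u : T) => if E w u then (1 : ℝ) else 0).mulVecLin
  have hf : LinearMap.ker f ≠ ⊥ := LinearMap.ker_ne_bot_of_finrank_lt (by simpa using h)
  obtain ⟨x, hx, hx0⟩ := Submodule.exists_mem_ne_zero_of_ne_bot hf
  obtain ⟨u, hu⟩ := Function.ne_iff.mp hx0
  refine ⟨fun a => if ha : a ∈ T then x ⟨a, ha⟩ else 0, ⟨u, u.2, by simpa using hu⟩, fun w hw => ?_⟩
  have := congrFun (LinearMap.mem_ker.mp hx) ⟨w, hw⟩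
  simp only [f, Matrix.mulVecLin_apply, Matrix.mulVec, dotProduct, Matrix.of_apply, ite_mul, one_mul,
    zero_mul, Pi.zero_apply] at this
  rw [Finset.sum_filter, ← Finset.sum_coe_sort T]
  exact (Finset.sum_congr rfl fun i _ => by simp).trans this

theorem exists_pos_and_neg {α : Type} {T : Finset α} {x : α → ℝ} (h : ∑ u ∈ T, x u = 0)
    {u : α} (hu : u ∈ T) (hx : x u ≠ 0) : (∃ a ∈ T, 0 < x a) ∧ ∃ b ∈ T, x b < 0 := by
  have h1 := Finset.exists_pos_of_sum_zero_of_exists_nonzero x h ⟨u, hu, hx⟩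
  have h2 := Finset.exists_pos_of_sum_zero_of_exists_nonzero (fun a => - x a) (s := T)
    (by simpa using h) ⟨u, hu, by simpa using hx⟩
  simpa using And.intro h1 h2

/-- A split pair of maximal size among those contained in `X` leaves no room: any further set
`T ⊆ X` has at least as many neighbors that do not see the pair as it has elements. -/
theorem SplitPair.card_le_of_maximal [Fintype V] [DecidableEq V] {A B : Finset V} {X : Set V}
    (hAB : SplitPair G A B) (hX : ∀ u ∈ A ∪ B, u ∈ X)
    (hmax : ∀ A' B', SplitPair G A' B' → (∀ u ∈ A' ∪ B', u ∈ X) → (A' ∪ B').card ≤ (A ∪ B).card)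
    {T M : Finset V} (hT : ∀ u ∈ T, u ∈ X) (hdisj : Disjoint T (A ∪ B))
    (hM : ∀ w, (∃ u ∈ T, G.Adj w u) → (∀ u ∈ A ∪ B, ¬ G.Adj w u) → w ∈ M) :
    T.card ≤ M.card := by
  classical
  by_contra! hlt
  obtain ⟨x, ⟨u₀, hu₀, hx₀⟩, hx⟩ := exists_ne_zero_sum_eq_zero G.Adj T M hlt
  let P := T.filter (0 < x ·)
  let Q := T.filter (x · < 0)
  have hmem {u : V} : (u ∈ A ∪ P ∨ u ∈ B ∪ Q) ↔ (u ∈ A ∨ u ∈ B) ∨ (u ∈ T ∧ x u ≠ 0) := by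
    simp only [Finset.mem_union, P, Q, Finset.mem_filter, ne_iff_lt_or_gt]
    tauto
  have key (u : V) (hu : u ∈ A ∪ P ∨ u ∈ B ∪ Q) (v : V) (hv : G.Adj v u) :
      (∃ a ∈ A ∪ P, G.Adj v a) ∧ ∃ b ∈ B ∪ Q, G.Adj v b := by
    -- A node seeing the old pair already sees both of its halves; any other node lies in `M`, so
    -- its equation forces both signs.
    by_cases hex : ∃ u' ∈ A ∪ B, G.Adj v u'
    · obtain ⟨u', hu', hvu'⟩ := hex
      rw [Finset.mem_union] at hu'
      obtain ⟨a, ha, hva⟩ := hAB.left u' hu' v hvu'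
      obtain ⟨b, hb, hvb⟩ := hAB.right u' hu' v hvu'
      exact ⟨⟨a, Finset.mem_union_left _ ha, hva⟩, b, Finset.mem_union_left _ hb, hvb⟩
    · push Not at hex
      rcases hmem.mp hu with h | ⟨huT, hux⟩
      · exact absurd hv (hex u (Finset.mem_union.mpr h))
      · obtain ⟨⟨a, ha, hxa⟩, b, hb, hxb⟩ := exists_pos_and_neg (hx v (hM v ⟨u, huT, hv⟩ hex))
          (Finset.mem_filter.mpr ⟨huT, hv⟩) hux
        rw [Finset.mem_filter] at ha hb
        exact ⟨⟨a, Finset.mem_union_right _ (Finset.mem_filter.mpr ⟨ha.1, hxa⟩), ha.2⟩,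
          b, Finset.mem_union_right _ (Finset.mem_filter.mpr ⟨hb.1, hxb⟩), hb.2⟩
  have hnew : SplitPair G (A ∪ P) (B ∪ Q) := by
    refine ⟨?_, fun u hu v hv => (key u hu v hv).1, fun u hu v hv => (key u hu v hv).2⟩
    have h0 := hAB.disjoint
    rw [Finset.disjoint_left] at h0 hdisj ⊢
    intro u hu hu'
    simp only [P, Q, Finset.mem_union, Finset.mem_filter] at hu hu' hdisj
    rcases hu with hu | hu <;> rcases hu' with hu' | hu'
    · exact h0 hu hu'
    · exact hdisj hu'.1 (.inl hu)
    · exact hdisj hu.1 (.inr hu')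
    · exact lt_asymm hu.2 hu'.2
  have hlt' : (A ∪ B).card < ((A ∪ P) ∪ (B ∪ Q)).card := by
    refine Finset.card_lt_card ⟨fun u hu => ?_, fun h => ?_⟩
    · rw [Finset.mem_union, hmem, ← Finset.mem_union]
      exact .inl hu
    · exact Finset.disjoint_left.mp hdisj hu₀
        (h (Finset.mem_union.mpr (hmem.mpr (.inr ⟨hu₀, hx₀⟩))))
  refine absurd (hmax _ _ hnew fun u hu => ?_) (not_le.mpr hlt')
  rcases hmem.mp (Finset.mem_union.mp hu) with h | h
  · exact hX u (Finset.mem_union.mpr h)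
  · exact hT u h.1

/-- Around every left node there is a split pair of small radius that the node sees. -/
theorem exists_splitPair [Fintype V] [DecidableEq V] [G.LocallyFinite] {side : V → Side}
    (hbip : IsBipartition G side) {δ r K : ℕ} (hr : 1 ≤ r) (hδ : 1 ≤ δ)
    (hL : ∀ v, side v = .left → δ ≤ G.degree v) (hR : ∀ u, side u = .right → G.degree u ≤ r)
    (hK : Fintype.card V * r ^ K ≤ δ ^ K) {v : V} (hv : side v = .left) :
    ∃ A B : Finset V, SplitPair G A B ∧
      (∀ u ∈ A ∪ B, side u = .right ∧ Within G (2 * K + 1) v u) ∧ ∃ u ∈ A ∪ B, G.Adj v u := by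
  classical
  let X : Set V := {u | side u = .right ∧ Within G (2 * K + 1) v u}
  obtain ⟨⟨A, B⟩, hAB, hmax⟩ := Finset.exists_max_image
    (Finset.univ.filter fun c : Finset V × Finset V =>
      SplitPair G c.1 c.2 ∧ ∀ u ∈ c.1 ∪ c.2, u ∈ X) (fun c => (c.1 ∪ c.2).card)
    ⟨(∅, ∅), by simpa using ⟨by simp, by simp, by simp⟩⟩
  simp only [Finset.mem_filter, Finset.mem_univ, true_and, Prod.forall] at hAB hmax
  refine ⟨A, B, hAB.1, hAB.2, ?_⟩
  by_contra! hno
  have hopp {a b : V} (h : G.Adj a b) : side a = .left ↔ side b = .right := by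
    have := hbip a b h
    cases ha : side a <;> cases hb : side b <;> simp_all
  -- `S` has at least `(δ / r) ^ j` left nodes, all missing the pair; the inequality is kept free of
  -- division.
  have layers : ∀ j ≤ K, ∃ S : Finset V, δ ^ j ≤ S.card * r ^ j ∧
      ∀ w ∈ S, side w = .left ∧ Within G (2 * j) v w ∧ ∀ u ∈ A ∪ B, ¬ G.Adj w u := by
    intro j
    induction j with
    | zero =>
      refine fun _ => ⟨{v}, by simp, fun w hw => ?_⟩
      obtain rfl := Finset.mem_singleton.mp hw
      exact ⟨hv, .refl _, hno⟩
    | succ j ih =>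
      intro hj
      obtain ⟨S, hS, hS'⟩ := ih (by omega)
      let T : Finset V := Finset.univ.filter fun u => ∃ w ∈ S, G.Adj w u
      let M : Finset V := Finset.univ.filter fun w =>
        (∃ u ∈ T, G.Adj w u) ∧ ∀ u ∈ A ∪ B, ¬ G.Adj w u
      have hT {u : V} (hu : u ∈ T) : side u = .right ∧ Within G (2 * j + 1) v u := by
        obtain ⟨w, hw, hwu⟩ := (Finset.mem_filter.mp hu).2
        exact ⟨(hopp hwu).mp (hS' w hw).1, (hS' w hw).2.1.concat hwu⟩
      have hTM : T.card ≤ M.card := by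
        refine hAB.1.card_le_of_maximal hAB.2 (fun A' B' h h' => hmax A' B' ⟨h, h'⟩)
          (fun u hu => ⟨(hT hu).1, (hT hu).2.mono (by omega)⟩) ?_
          fun w h h' => Finset.mem_filter.mpr ⟨Finset.mem_univ _, h, h'⟩
        refine Finset.disjoint_left.mpr fun u hu huAB => ?_
        obtain ⟨w, hw, hwu⟩ := (Finset.mem_filter.mp hu).2
        exact (hS' w hw).2.2 u huAB hwu
      -- Double counting of the edges between `S` and `T`.
      have hST : S.card * δ ≤ T.card * r := by
        refine Finset.card_mul_le_card_mul G.Adj (fun w hw => ?_) fun u hu => ?_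
        · refine (hL w (hS' w hw).1).trans ?_
          rw [← G.card_neighborFinset_eq_degree]
          refine Finset.card_le_card fun u hu => ?_
          rw [G.mem_neighborFinset] at hu
          exact Finset.mem_filter.mpr
            ⟨Finset.mem_filter.mpr ⟨Finset.mem_univ _, w, hw, hu⟩, hu⟩
        · refine le_trans ?_ (hR u (hT hu).1)
          rw [← G.card_neighborFinset_eq_degree]
          refine Finset.card_le_card fun w hw => ?_
          rw [G.mem_neighborFinset]
          exact (Finset.mem_filter.mp hw).2.symm
      refine ⟨M, ?_, fun w hw => ?_⟩
      · calc δ ^ (j + 1) = δ ^ j * δ := pow_succ _ _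
          _ ≤ S.card * r ^ j * δ := by gcongr
          _ = S.card * δ * r ^ j := by ring
          _ ≤ T.card * r * r ^ j := by gcongr
          _ ≤ M.card * r * r ^ j := by gcongr
          _ = M.card * r ^ (j + 1) := by ring
      · obtain ⟨⟨u, hu, hwu⟩, hw'⟩ := (Finset.mem_filter.mp hw).2
        exact ⟨(hopp hwu).mpr (hT hu).1, (hT hu).2.concat hwu.symm, hw'⟩
  obtain ⟨S, hS, hS'⟩ := layers K le_rfl
  have hcard : Fintype.card V ≤ S.card :=
    Nat.le_of_mul_le_mul_right (hK.trans hS) (by positivity)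
  -- All nodes would be left nodes, yet `v` has a right neighbor.
  have huniv : S = Finset.univ := Finset.card_eq_iff_eq_univ S |>.mp (le_antisymm (Finset.card_le_univ S) hcard)
  obtain ⟨u, hu⟩ : (G.neighborFinset v).Nonempty := by
    rw [← Finset.card_pos, G.card_neighborFinset_eq_degree]
    exact hδ.trans (hL v hv)
  rw [G.mem_neighborFinset] at hu
  have h1 := (hopp hu).mp hv
  have h2 := (hS' u (huniv ▸ Finset.mem_univ u)).1
  simp [h1] at h2

end Existence

/-! ### The algorithm -/

/-- Local states of the splitting algorithm: a node collects records of right nodes with their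
neighbors, then pairs of identifier sets. -/
structure SplittingState where
  clock : ℕ
  radius : ℕ
  id : ℕ
  side : Side
  records : Set (ℕ × Set ℕ)
  pairs : Set (Finset ℕ × Finset ℕ)

/-- The given records witness that `c` is a pair of disjoint sets each seen by all neighbors of
their members. -/
def CertifiesPair (recs : Set (ℕ × Set ℕ)) (c : Finset ℕ × Finset ℕ) : Prop :=
  Disjoint c.1 c.2 ∧ ∀ i, i ∈ c.1 ∨ i ∈ c.2 → ∃ S, (i, S) ∈ recs ∧ ∀ w ∈ S,
    (∃ j ∈ c.1, ∃ S', (j, S') ∈ recs ∧ w ∈ S') ∧ ∃ j ∈ c.2, ∃ S', (j, S') ∈ recs ∧ w ∈ S'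

open Classical in
/-- The color of the node `i`, according to the first of the given pairs that contains `i`. -/
noncomputable def chosenColor (P : Set (Finset ℕ × Finset ℕ)) (i : ℕ) : Color :=
  if h : {c ∈ P | i ∈ c.1 ∨ i ∈ c.2}.Nonempty then
    if i ∈ (Function.argminOn Encodable.encode _ h).1 then .red else .blue
  else .red

/-- A radius within which every left node sees a split pair. -/
noncomputable def splittingRadius (p : SplittingParams) : ℕ :=
  2 * ⌈Real.logb ((p.δ : ℝ) / (p.r : ℝ)) (p.n : ℝ)⌉₊ + 1

open Classical in
/-- Learn the neighbors, flood the records of the right nodes, form all certified pairs, flood these,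
and let every node follow the first pair that contains it. -/
noncomputable def splittingAlgorithm : LocalAlgorithm SplittingParams Side Color where
  State := SplittingState
  Msg := SplittingState
  rounds p := if p.n < p.δ then 0 else 1 + splittingRadius p + splittingRadius p
  init p id _ side := ⟨0, splittingRadius p, id, side, ∅, ∅⟩
  send _ s _ := s
  receive _ s m :=
    let recs : Set (ℕ × Set ℕ) :=
      if s.clock = 0 then {x | s.side = .right ∧ x = (s.id, Set.range fun i => (m i).id)}
      else s.records ∪ ⋃ i, (m i).records
    { s with
      clock := s.clock + 1
      records := recs
      -- Pairs are recomputed from scratch until the records reach the full radius; only then does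
      -- flooding of pairs begin.
      pairs := if s.clock ≤ s.radius then {c | CertifiesPair recs c}
        else s.pairs ∪ ⋃ i, (m i).pairs }
  output s := chosenColor s.pairs s.id

/-! ### Correctness of following the first certified pair -/

namespace Network

variable {V : Type} (N : Network V Side)

/-- The records of the right nodes at distance at most `t` from `v`. -/
def recordsWithin (t : ℕ) (v : V) : Set (ℕ × Set ℕ) :=
  {x | ∃ u, N.input u = .right ∧ Within N.graph t v u ∧ x = (N.id u, N.id '' N.graph.neighborSet u)}

/-- The pairs certified by the records around some node at distance at most `t` from `v`. -/
def pairsWithin (ρ t : ℕ) (v : V) : Set (Finset ℕ × Finset ℕ) :=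
  {c | ∃ w, Within N.graph t v w ∧ CertifiesPair (N.recordsWithin ρ w) c}

variable {N}

theorem mem_recordsWithin_succ {t : ℕ} {v : V} {x : ℕ × Set ℕ} :
    x ∈ N.recordsWithin (t + 1) v ↔
      x ∈ N.recordsWithin t v ∨ ∃ i, x ∈ N.recordsWithin t (N.port v i).1 := by
  simp only [recordsWithin, Set.mem_ofPred_eq, Within.succ_iff]
  constructor
  · rintro ⟨u, hu, h | ⟨w, hvw, h⟩, rfl⟩
    · exact .inl ⟨u, hu, h, rfl⟩
    · exact .inr ⟨(N.port v).symm ⟨w, hvw⟩, u, hu, by simpa using h, rfl⟩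
  · rintro (⟨u, hu, h, rfl⟩ | ⟨i, u, hu, h, rfl⟩)
    · exact ⟨u, hu, .inl h, rfl⟩
    · exact ⟨u, hu, .inr ⟨_, (N.port v i).2, h⟩, rfl⟩

theorem mem_pairsWithin_succ {ρ t : ℕ} {v : V} {c : Finset ℕ × Finset ℕ} :
    c ∈ N.pairsWithin ρ (t + 1) v ↔
      c ∈ N.pairsWithin ρ t v ∨ ∃ i, c ∈ N.pairsWithin ρ t (N.port v i).1 := by
  simp only [pairsWithin, Set.mem_ofPred_eq, Within.succ_iff]
  constructor
  · rintro ⟨u, h | ⟨w, hvw, h⟩, hc⟩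
    · exact .inl ⟨u, h, hc⟩
    · exact .inr ⟨(N.port v).symm ⟨w, hvw⟩, u, by simpa using h, hc⟩
  · rintro (⟨u, h, hc⟩ | ⟨i, u, h, hc⟩)
    · exact ⟨u, .inl h, hc⟩
    · exact ⟨u, .inr ⟨_, (N.port v i).2, h⟩, hc⟩

theorem mem_recordsWithin_zero {v : V} {x : ℕ × Set ℕ} :
    x ∈ N.recordsWithin 0 v ↔
      N.input v = .right ∧ x = (N.id v, Set.range fun i => N.id (N.port v i).1) := by
  have : (Set.range fun i => N.id (N.port v i).1) = N.id '' N.graph.neighborSet v := by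
    ext j
    simp only [Set.mem_range, Set.mem_image]
    constructor
    · rintro ⟨i, rfl⟩
      exact ⟨_, (N.port v i).2, rfl⟩
    · rintro ⟨w, hw, rfl⟩
      exact ⟨(N.port v).symm ⟨w, hw⟩, by simp⟩
  simp [recordsWithin, Within.zero_iff, this]

theorem _root_.CertifiesPair.of_splitPair [DecidableEq V] {ρ : ℕ} {v : V} {A B : Finset V}
    (h : SplitPair N.graph A B)
    (hAB : ∀ u ∈ A ∪ B, N.input u = .right ∧ Within N.graph ρ v u) :
    CertifiesPair (N.recordsWithin ρ v) (A.image N.id, B.image N.id) := by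
  have hrec {u : V} (hu : u ∈ A ∨ u ∈ B) :
      (N.id u, N.id '' N.graph.neighborSet u) ∈ N.recordsWithin ρ v :=
    ⟨u, (hAB u (Finset.mem_union.mpr hu)).1, (hAB u (Finset.mem_union.mpr hu)).2, rfl⟩
  refine ⟨(Finset.disjoint_image N.id_injective).mpr h.disjoint, fun i hi => ?_⟩
  obtain ⟨u, hu, rfl⟩ : ∃ u, (u ∈ A ∨ u ∈ B) ∧ N.id u = i := by
    simp only [Finset.mem_image] at hi
    rcases hi with ⟨u, hu, rfl⟩ | ⟨u, hu, rfl⟩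
    exacts [⟨u, .inl hu, rfl⟩, ⟨u, .inr hu, rfl⟩]
  refine ⟨_, hrec hu, ?_⟩
  rintro _ ⟨w, hw, rfl⟩
  obtain ⟨a, ha, hwa⟩ := h.left u hu w (SimpleGraph.Adj.symm hw)
  obtain ⟨b, hb, hwb⟩ := h.right u hu w (SimpleGraph.Adj.symm hw)
  exact ⟨⟨_, Finset.mem_image_of_mem _ ha, _, hrec (.inl ha), w, hwa.symm, rfl⟩,
    _, Finset.mem_image_of_mem _ hb, _, hrec (.inr hb), w, hwb.symm, rfl⟩

/-- Identifiers are injective, so a record of `N.id u` stems from `u` itself. Hence flooding pairs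
to distance `ρ` reaches all their members. -/
theorem _root_.CertifiesPair.within {ρ : ℕ} {w u : V} {c : Finset ℕ × Finset ℕ}
    (h : CertifiesPair (N.recordsWithin ρ w) c) (hu : N.id u ∈ c.1 ∨ N.id u ∈ c.2) :
    Within N.graph ρ w u := by
  obtain ⟨S, ⟨u', -, hu', heq⟩, -⟩ := h.2 _ hu
  obtain rfl := N.id_injective (Prod.ext_iff.mp heq).1
  exact hu'

theorem _root_.CertifiesPair.exists_adj {ρ : ℕ} {w u v : V} {c : Finset ℕ × Finset ℕ}
    (h : CertifiesPair (N.recordsWithin ρ w) c) (hu : N.id u ∈ c.1 ∨ N.id u ∈ c.2)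
    (hv : N.graph.Adj v u) :
    (∃ a, N.id a ∈ c.1 ∧ N.graph.Adj v a) ∧ ∃ b, N.id b ∈ c.2 ∧ N.graph.Adj v b := by
  obtain ⟨S, ⟨u', -, -, heq⟩, hS⟩ := h.2 _ hu
  obtain ⟨hid, rfl⟩ := Prod.ext_iff.mp heq
  obtain rfl := N.id_injective hid
  have aux {j : ℕ} {S' : Set ℕ} (hj : (j, S') ∈ N.recordsWithin ρ w) (hvS : N.id v ∈ S') :
      ∃ a, N.id a = j ∧ N.graph.Adj v a := by
    obtain ⟨a, -, -, heq⟩ := hj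
    obtain ⟨rfl, rfl⟩ := Prod.ext_iff.mp heq
    obtain ⟨v', hv', hid⟩ := hvS
    obtain rfl := N.id_injective hid
    exact ⟨a, rfl, SimpleGraph.Adj.symm hv'⟩
  obtain ⟨⟨j, hj, S₁, hS₁, hv₁⟩, k, hk, S₂, hS₂, hv₂⟩ := hS _ ⟨v, hv.symm, rfl⟩
  obtain ⟨a, rfl, ha⟩ := aux hS₁ hv₁
  obtain ⟨b, rfl, hb⟩ := aux hS₂ hv₂
  exact ⟨⟨a, hj, ha⟩, b, hk, hb⟩

theorem chosenColor_eq {P : Set (Finset ℕ × Finset ℕ)} {i : ℕ} {c : Finset ℕ × Finset ℕ}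
    (hc : c ∈ P) (hi : i ∈ c.1 ∨ i ∈ c.2) (hdisj : Disjoint c.1 c.2)
    (hmin : ∀ c' ∈ P, i ∈ c'.1 ∨ i ∈ c'.2 → Encodable.encode c ≤ Encodable.encode c') :
    (i ∈ c.1 → chosenColor P i = .red) ∧ (i ∈ c.2 → chosenColor P i = .blue) := by
  have h : {c ∈ P | i ∈ c.1 ∨ i ∈ c.2}.Nonempty := ⟨c, hc, hi⟩
  have hmem := Function.argminOn_mem (Encodable.encode : Finset ℕ × Finset ℕ → ℕ) _ h
  have hle := Function.argminOn_le (Encodable.encode : Finset ℕ × Finset ℕ → ℕ) _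
    (show c ∈ {c ∈ P | i ∈ c.1 ∨ i ∈ c.2} from ⟨hc, hi⟩)
  have heq := Encodable.encode_injective (le_antisymm hle (hmin _ hmem.1 hmem.2))
  rw [chosenColor, dif_pos h, heq]
  exact ⟨fun h1 => if_pos h1, fun h2 => if_neg (Finset.disjoint_right.mp hdisj h2)⟩

/-- If every left node sees a split pair within distance `ρ`, following the first of all certified
pairs is a weak splitting. -/
theorem isWeakSplitting_chosenColor [DecidableEq V] {ρ : ℕ} (hbip : IsBipartition N.graph N.input)
    (hex : ∀ v, N.input v = .left → ∃ A B : Finset V, SplitPair N.graph A B ∧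
      (∀ u ∈ A ∪ B, N.input u = .right ∧ Within N.graph ρ v u) ∧ ∃ u ∈ A ∪ B, N.graph.Adj v u) :
    IsWeakSplitting N.graph N.input fun v => chosenColor (N.pairsWithin ρ ρ v) (N.id v) := by
  intro v hv
  -- Certifying nodes at any distance are allowed, so that `F` contains every pair known to a
  -- neighbor of `v` and containing that neighbor.
  let F : Set (Finset ℕ × Finset ℕ) := {c | (∃ w, CertifiesPair (N.recordsWithin ρ w) c) ∧
    ∃ u, N.graph.Adj v u ∧ (N.id u ∈ c.1 ∨ N.id u ∈ c.2)}
  have hF : F.Nonempty := by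
    obtain ⟨A, B, hAB, h, u, hu, hvu⟩ := hex v hv
    refine ⟨(A.image N.id, B.image N.id), ⟨v, .of_splitPair hAB h⟩, u, hvu, ?_⟩
    rw [Finset.mem_union] at hu
    exact hu.imp (Finset.mem_image_of_mem _) (Finset.mem_image_of_mem _)
  obtain ⟨c, ⟨⟨w, hw⟩, u, hvu, hu⟩, hmin⟩ :
      ∃ c ∈ F, ∀ c' ∈ F, Encodable.encode c ≤ Encodable.encode c' :=
    ⟨Function.argminOn Encodable.encode F hF, Function.argminOn_mem _ _ _,
      fun c' hc' => Function.argminOn_le _ _ hc'⟩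
  have key {a : V} (ha : N.graph.Adj v a) (hac : N.id a ∈ c.1 ∨ N.id a ∈ c.2) :=
    chosenColor_eq (P := N.pairsWithin ρ ρ a) ⟨w, (CertifiesPair.within hw hac).symm, hw⟩ hac hw.1
      fun c' hc' ha' => hmin c' ⟨⟨hc'.choose, hc'.choose_spec.2⟩, a, ha, ha'⟩
  have hright {a : V} (ha : N.graph.Adj v a) : N.input a = .right := by
    have := hbip v a ha
    cases h : N.input a <;> simp_all
  obtain ⟨⟨a, ha, hva⟩, b, hb, hvb⟩ := CertifiesPair.exists_adj hw hu hvu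
  intro k
  cases k with
  | red => exact ⟨a, hva, hright hva, (key hva (.inl ha)).1 ha⟩
  | blue => exact ⟨b, hvb, hright hvb, (key hvb (.inr hb)).2 hb⟩

end Network

/-! ### The states computed by the algorithm -/

namespace splittingAlgorithm

variable {V : Type} (p : SplittingParams) (N : Network V Side)

theorem stateAfter_const (t : ℕ) (v : V) :
    (splittingAlgorithm.stateAfter p N t v).clock = t ∧
    (splittingAlgorithm.stateAfter p N t v).radius = splittingRadius p ∧
    (splittingAlgorithm.stateAfter p N t v).id = N.id v ∧
    (splittingAlgorithm.stateAfter p N t v).side = N.input v := by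
  induction t with
  | zero => exact ⟨rfl, rfl, rfl, rfl⟩
  | succ t ih => exact ⟨congrArg (· + 1) ih.1, ih.2⟩

/-- The shift by one is the first round, spent on learning the neighbors' identifiers. -/
theorem records_stateAfter (t : ℕ) (v : V) :
    (splittingAlgorithm.stateAfter p N (t + 1) v).records = N.recordsWithin t v := by
  induction t generalizing v with
  | zero =>
    ext x
    rw [Network.mem_recordsWithin_zero]
    exact Iff.rfl
  | succ t ih =>
    have h : (splittingAlgorithm.stateAfter p N (t + 1 + 1) v).records =
        if (splittingAlgorithm.stateAfter p N (t + 1) v).clock = 0 then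
          {x | (splittingAlgorithm.stateAfter p N (t + 1) v).side = .right ∧
            x = ((splittingAlgorithm.stateAfter p N (t + 1) v).id,
              Set.range fun i => (splittingAlgorithm.stateAfter p N (t + 1) (N.port v i).1).id)}
        else
          (splittingAlgorithm.stateAfter p N (t + 1) v).records ∪
            ⋃ i, (splittingAlgorithm.stateAfter p N (t + 1) (N.port v i).1).records := rfl
    ext x
    rw [h, (stateAfter_const p N _ v).1, if_neg (Nat.succ_ne_zero t), Network.mem_recordsWithin_succ]
    simp only [ih, Set.mem_union, Set.mem_iUnion]

theorem pairs_stateAfter (t : ℕ) (v : V) :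
    (splittingAlgorithm.stateAfter p N (1 + splittingRadius p + t) v).pairs =
      N.pairsWithin (splittingRadius p) t v := by
  have h (s : ℕ) (v : V) : (splittingAlgorithm.stateAfter p N (s + 1) v).pairs =
      if (splittingAlgorithm.stateAfter p N s v).clock ≤
          (splittingAlgorithm.stateAfter p N s v).radius then
        {c | CertifiesPair (splittingAlgorithm.stateAfter p N (s + 1) v).records c}
      else (splittingAlgorithm.stateAfter p N s v).pairs ∪
        ⋃ i, (splittingAlgorithm.stateAfter p N s (N.port v i).1).pairs := rfl
  induction t generalizing v with
  | zero =>
    rw [add_zero, add_comm, h, (stateAfter_const p N _ v).1, (stateAfter_const p N _ v).2.1,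
      if_pos le_rfl, records_stateAfter]
    ext c
    simp [Network.pairsWithin, Within.zero_iff]
  | succ t ih =>
    ext c
    rw [← add_assoc, h, (stateAfter_const p N _ v).1, (stateAfter_const p N _ v).2.1,
      if_neg (by omega), Network.mem_pairsWithin_succ]
    simp only [ih, Set.mem_union, Set.mem_iUnion]

theorem run_eq (h : ¬ p.n < p.δ) (v : V) : splittingAlgorithm.run p N v =
    chosenColor (N.pairsWithin (splittingRadius p) (splittingRadius p) v) (N.id v) := by
  have h1 : splittingAlgorithm.run p N v =
      chosenColor (splittingAlgorithm.stateAfter p N (splittingAlgorithm.rounds p) v).pairs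
        (splittingAlgorithm.stateAfter p N (splittingAlgorithm.rounds p) v).id := rfl
  rw [h1, (stateAfter_const p N _ v).2.2.1,
    show splittingAlgorithm.rounds p = 1 + splittingRadius p + splittingRadius p from if_neg h,
    pairs_stateAfter]

end splittingAlgorithm

/-! ### The round bound and the main theorem -/

/-- There is one deterministic LOCAL algorithm, and one absolute constant `C`, such that for all `n ≥ 1`,
`r ≥ 1` and `δ ≥ 2 (r + 1)` the algorithm uses at most `C * log_{δ/r} n` rounds and solves weak
splitting on every bipartite graph with `n` nodes, left degrees at least `δ` and right degrees at
most `r`, for all identifiers and port numberings. -/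
theorem corollary1p8 :
    ∃ (A : LocalAlgorithm SplittingParams Side Color) (C : ℝ),
      ∀ n δ r : ℕ, 1 ≤ n → 1 ≤ r → 2 * (r + 1) ≤ δ →
        (A.rounds ⟨n, δ, r⟩ : ℝ) ≤ C * Real.logb ((δ : ℝ) / (r : ℝ)) (n : ℝ) ∧
        ∀ (V : Type) [Fintype V] (N : Network V Side),
          Fintype.card V = n →
          IsBipartition N.graph N.input →
          (∀ v, N.input v = Side.left → δ ≤ N.graph.degree v) →
          (∀ u, N.input u = Side.right → N.graph.degree u ≤ r) →
          IsWeakSplitting N.graph N.input (A.run ⟨n, δ, r⟩ N) := by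
  classical
  -- With `L` the logarithm, the rounds number `3 + 4 * ⌈L⌉₊ < 7 + 4 * L ≤ 11 * L` once `1 ≤ L`,
  -- which holds when `δ ≤ n`.
  refine ⟨splittingAlgorithm, 11, fun n δ r hn hr hδ => ?_⟩
  have hr' : (1 : ℝ) ≤ r := by exact_mod_cast hr
  have hn' : (1 : ℝ) ≤ n := by exact_mod_cast hn
  have hδ' : 2 * ((r : ℝ) + 1) ≤ δ := by exact_mod_cast hδ
  have hq : 1 < (δ : ℝ) / r := by
    rw [lt_div_iff₀ (by linarith)]
    linarith
  have hlog := Real.logb_nonneg hq hn'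
  constructor
  · by_cases h : n < δ
    · rw [show splittingAlgorithm.rounds ⟨n, δ, r⟩ = 0 from if_pos h]
      simpa using hlog
    · rw [show splittingAlgorithm.rounds ⟨n, δ, r⟩ =
        1 + splittingRadius ⟨n, δ, r⟩ + splittingRadius ⟨n, δ, r⟩ from if_neg h]
      have h1 : 1 ≤ Real.logb ((δ : ℝ) / r) n := by
        rw [Real.le_logb_iff_rpow_le hq (by linarith), Real.rpow_one]
        refine (div_le_self (by linarith) hr').trans ?_
        exact_mod_cast not_lt.mp h
      have h2 := Nat.ceil_lt_add_one hlog
      simp only [splittingRadius]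
      push_cast
      linarith
  · intro V _ N hcard hbip hL hR
    -- A left node would need more than `n` nodes, so there is none and zero rounds suffice.
    by_cases h : n < δ
    · intro v hv
      have := (hL v hv).trans (Finset.card_le_univ (N.graph.neighborFinset v))
      omega
    · rw [funext (splittingAlgorithm.run_eq ⟨n, δ, r⟩ N h)]
      refine Network.isWeakSplitting_chosenColor hbip fun v hv =>
        exists_splitPair hbip hr (by omega) hL hR ?_ hv
      have hK : (n : ℝ) ≤ ((δ : ℝ) / r) ^ ⌈Real.logb ((δ : ℝ) / (r : ℝ)) (n : ℝ)⌉₊ := by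
        rw [← Real.rpow_natCast, ← Real.logb_le_iff_le_rpow hq (by linarith)]
        exact Nat.le_ceil _
      rw [div_pow, le_div_iff₀ (by positivity)] at hK
      rw [hcard]
      exact_mod_cast hK
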